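/- Let $\theta$ be a real algebraic integer of degree $3$, let $q \ge 0$ be an integer and let $\varepsilon > 0$. For $w = c_0 + c_1\theta + c_2\theta^2 \in \mathbb{Z}[\theta]$ with $c_0, c_1, c_2 \in \mathbb{Z}$ put $M_\theta(w) = \max\{|c_0|, |c_1|, |c_2|\}$. For real $Y_1, Y_2$ let $\mathcal{E}_{\theta,q}(Y_1,Y_2)$ be the set of integers $n$ with $|n| \le Y_2$ for which $q^2(n-\theta) = w_1^2 + w_2^2$ for some $w_1, w_2 \in \mathbb{Z}[\theta]$ with $M_\theta(w_1), M_\theta(w_2) \le Y_1$, and let $\mathcal{R}_{\theta,q}(Y_1,Y_2)$ be the set of pairs $(\omega_1,\omega_2) \in \mathbb{Z}[\theta]^2$ with $M_\theta(\omega_1), M_\theta(\omega_2) \le Y_1$ such that $\omega_1^2 + \omega_2^2 = q^2(n-\theta)$ for some integer $n$ with $|n| \le Y_2$. Then there is a constant $C > 0$, depending only on $q$, $\varepsilon$ and $\theta$, such that for all real $Y_1, Y_2 \ge 2$ both sets are finite and $$\#\mathcal{E}_{\theta,q}(Y_1,Y_2) \ge C \cdot \#\mathcal{R}_{\theta,q}(Y_1,Y_2)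 \cdot Y_2^{-\varepsilon} \cdot (\log Y_1)^{-2}.$$ -/

import Mathlib

namespace CubicSquares

/-- The ring `ℤ[θ]`, as a subring (`ℤ`-subalgebra) of `ℝ`. -/
def Zring (θ : ℝ) : Subalgebra ℤ ℝ := Algebra.adjoin ℤ {θ}

/-- The maximum coefficient of `w = c₀ + c₁ θ + c₂ θ²`, that is `max |c₀| |c₁| |c₂|`.
For `θ` an algebraic integer of degree three every `w ∈ ℤ[θ]` has exactly one such expansion, so
the set below is a singleton, see `maxCoeff_eq` and `exists_coeffs`. -/
noncomputable def maxCoeff (θ w : ℝ) : ℕ :=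
  sInf {m : ℕ | ∃ c₀ c₁ c₂ : ℤ, w = c₀ + c₁ * θ + c₂ * θ ^ 2 ∧
    m = max (max c₀.natAbs c₁.natAbs) c₂.natAbs}

/-- Sums of two squares of elements of `ℤ[θ]` with coefficients at most `Y`. -/
def sumTwoSquares (θ Y : ℝ) : Set ℝ :=
  {w | ∃ w₁ ∈ Zring θ, ∃ w₂ ∈ Zring θ,
    (maxCoeff θ w₁ : ℝ) ≤ Y ∧ (maxCoeff θ w₂ : ℝ) ≤ Y ∧ w = w₁ ^ 2 + w₂ ^ 2}

/-- The integers `n` with `|n| ≤ Y₂` such that `q² (n - θ)` is a sum of two squares of elements of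
`ℤ[θ]` with coefficients at most `Y₁`. -/
def setE (θ : ℝ) (q : ℕ) (Y₁ Y₂ : ℝ) : Set ℤ :=
  {n | (q : ℝ) ^ 2 * ((n : ℝ) - θ) ∈ sumTwoSquares θ Y₁ ∧ |(n : ℝ)| ≤ Y₂}

/-- The pairs `(ω₁, ω₂)` of elements of `ℤ[θ]` with coefficients at most `Y₁` such that
`ω₁² + ω₂² = q² (n - θ)` for some integer `n` with `|n| ≤ Y₂`. -/
def setR (θ : ℝ) (q : ℕ) (Y₁ Y₂ : ℝ) : Set (ℝ × ℝ) :=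
  {ω | ω.1 ∈ Zring θ ∧ ω.2 ∈ Zring θ ∧ (maxCoeff θ ω.1 : ℝ) ≤ Y₁ ∧ (maxCoeff θ ω.2 : ℝ) ≤ Y₁ ∧
    ∃ n : ℤ, |(n : ℝ)| ≤ Y₂ ∧ ω.1 ^ 2 + ω.2 ^ 2 = (q : ℝ) ^ 2 * ((n : ℝ) - θ)}

/-- Uniqueness of coefficients when `θ` has degree three. -/
theorem coeffs_unique {θ : ℝ} (hdeg : (minpoly ℚ θ).natDegree = 3) {a₀ a₁ a₂ b₀ b₁ b₂ : ℤ}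
    (h : (a₀ : ℝ) + a₁ * θ + a₂ * θ ^ 2 = b₀ + b₁ * θ + b₂ * θ ^ 2) :
    a₀ = b₀ ∧ a₁ = b₁ ∧ a₂ = b₂ := by
  have hli := linearIndependent_pow (K := ℚ) θ
  rw [hdeg] at hli
  rw [Fintype.linearIndependent_iff] at hli
  have := hli ![((a₀ - b₀ : ℤ) : ℚ), ((a₁ - b₁ : ℤ) : ℚ), ((a₂ - b₂ : ℤ) : ℚ)] (by
    simp [Fin.sum_univ_three, Algebra.smul_def]
    linarith)
  have h0 := this 0
  have h1 := this 1
  have h2 := this 2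
  simp only [Matrix.cons_val, Int.cast_eq_zero] at h0 h1 h2
  omega

theorem maxCoeff_eq {θ : ℝ} (hdeg : (minpoly ℚ θ).natDegree = 3) (c₀ c₁ c₂ : ℤ) :
    maxCoeff θ (c₀ + c₁ * θ + c₂ * θ ^ 2) = max (max c₀.natAbs c₁.natAbs) c₂.natAbs := by
  have : {m : ℕ | ∃ d₀ d₁ d₂ : ℤ, (c₀ : ℝ) + c₁ * θ + c₂ * θ ^ 2 = d₀ + d₁ * θ + d₂ * θ ^ 2 ∧
      m = max (max d₀.natAbs d₁.natAbs) d₂.natAbs} =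
      {max (max c₀.natAbs c₁.natAbs) c₂.natAbs} := by
    ext m
    constructor
    · rintro ⟨d₀, d₁, d₂, h, rfl⟩
      obtain ⟨rfl, rfl, rfl⟩ := coeffs_unique hdeg h
      rfl
    · rintro rfl
      exact ⟨c₀, c₁, c₂, rfl, rfl⟩
  rw [maxCoeff, this, csInf_singleton]

/-- Existence of coefficients when `θ` is an algebraic integer of degree three. -/
theorem exists_coeffs {θ : ℝ} (hint : IsIntegral ℤ θ) (hdeg : (minpoly ℚ θ).natDegree = 3)
    {w : ℝ} (hw : w ∈ Zring θ) : ∃ c₀ c₁ c₂ : ℤ, w = c₀ + c₁ * θ + c₂ * θ ^ 2 := by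
  rw [Zring, Algebra.adjoin_singleton_eq_range_aeval] at hw
  obtain ⟨p, rfl⟩ := hw
  have hmonic := minpoly.monic hint
  have hd : (minpoly ℤ θ).natDegree = 3 := by
    rw [← hdeg, minpoly.isIntegrallyClosed_eq_field_fractions' ℚ hint, hmonic.natDegree_map]
  have hlt : (p %ₘ minpoly ℤ θ).natDegree < 3 := by
    rw [← hd]
    exact Polynomial.natDegree_modByMonic_lt p hmonic (by
      intro h
      rw [h] at hd
      simp at hd)
  have he : Polynomial.aeval θ p = Polynomial.aeval θ (p %ₘ minpoly ℤ θ) :=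
    (Polynomial.aeval_modByMonic_eq_self_of_root (minpoly.aeval ℤ θ)).symm
  refine ⟨(p %ₘ minpoly ℤ θ).coeff 0, (p %ₘ minpoly ℤ θ).coeff 1,
    (p %ₘ minpoly ℤ θ).coeff 2, ?_⟩
  change Polynomial.aeval θ p = _
  rw [he, Polynomial.aeval_eq_sum_range' hlt]
  simp [Finset.sum_range_succ]

end CubicSquares

/-! For `q ≠ 0` it suffices that each `n` has `O(Y₂ ^ ε (log Y₁) ^ 2)` representations. Over `K =
ℚ(θ, i)` a representation factors as `(ω₁ + iω₂)(ω₁ - iω₂) = m` with `m = q² (n - θ)`, so it gives a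
divisor of `m` in `𝓞 K` with all conjugates `O(Y₁)`, and this divisor determines the pair.

Such divisors are counted in two stages. The ideals dividing `(m)` number `O(N(m) ^ δ)`, and `N(m) =
O(Y₂ ^ d)` for `d = [K : ℚ]`, which gives `Y₂ ^ ε` (`exists_ncard_ideal_dvd_le`). Generators of one
ideal differ by units. Their norm is at least `1`, so an upper bound on all conjugates also bounds
them below, and the units have logarithms `O(log Y₁)`. Dirichlet's theorem leaves `O((log Y₁) ^
rank)` of them (`exists_ncard_generators_le`). As `K` is totally complex of degree at most `6`, its
unit rank is at most `2`, whence the exponent of the logarithm. -/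

namespace CubicSquares

/-! ### Divisor bound for ideals -/

open NumberField Ideal UniqueFactorizationMonoid

/-- `e + 1 ≤ c x ^ (δ e)` for `x ≥ 2`, with a constant `c` that depends only on `δ`. -/
theorem add_one_le_mul_rpow {δ : ℝ} (hδ : 0 < δ) {x : ℝ} (hx : 2 ≤ x) (e : ℕ) :
    (e + 1 : ℝ) ≤ (1 + (δ * Real.log 2)⁻¹) * (x ^ δ) ^ e := by
  have hl : 0 < Real.log 2 := Real.log_pos (by norm_num)
  have hd : 0 < δ * Real.log 2 := by positivity
  have h1 : 1 + δ * Real.log 2 ≤ x ^ δ := by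
    calc 1 + δ * Real.log 2 ≤ Real.exp (δ * Real.log 2) := by
          linarith [Real.add_one_le_exp (δ * Real.log 2)]
      _ = 2 ^ δ := by rw [Real.rpow_def_of_pos (by norm_num), mul_comm]
      _ ≤ x ^ δ := Real.rpow_le_rpow (by norm_num) hx hδ.le
  have h2 : 1 + e * (δ * Real.log 2) ≤ (x ^ δ) ^ e :=
    (one_add_mul_le_pow (by linarith) e).trans (by gcongr)
  -- With `d = δ log 2`, the product `(1 + d⁻¹)(1 + e d)` expands to `1 + e + d⁻¹ + e d`.
  calc (e + 1 : ℝ) ≤ (1 + (δ * Real.log 2)⁻¹) * (1 + e * (δ * Real.log 2)) := by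
        have : (δ * Real.log 2)⁻¹ * (δ * Real.log 2) = 1 := inv_mul_cancel₀ hd.ne'
        have h3 : 0 ≤ (δ * Real.log 2)⁻¹ := by positivity
        have h4 : 0 ≤ e * (δ * Real.log 2) := by positivity
        nlinarith
    _ ≤ _ := by gcongr

/-- `e + 1 ≤ x ^ (δ e)` for `x ^ δ ≥ 2`. -/
theorem add_one_le_pow_of_two_le {y : ℝ} (hy : 2 ≤ y) (e : ℕ) : (e + 1 : ℝ) ≤ y ^ e := by
  calc (e + 1 : ℝ) ≤ 2 ^ e := by exact_mod_cast Nat.lt_two_pow_self (n := e)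
    _ ≤ _ := by gcongr

section DedekindDomain

variable {R : Type*} [CommRing R] [IsDedekindDomain R]

open Classical in
/-- The number of ideals dividing `I` is at most `∏ (e_P + 1)`. -/
theorem ncard_dvd_le_prod {I : Ideal R} (hI : I ≠ 0) :
    {J : Ideal R | J ∣ I}.Finite ∧ {J : Ideal R | J ∣ I}.ncard ≤
      ∏ P ∈ (normalizedFactors I).toFinset, ((normalizedFactors I).count P + 1) := by
  set s := normalizedFactors I
  let T : Finset (Multiset (Ideal R)) := (Multiset.powerset s).toFinset
  have hmaps : Set.MapsTo normalizedFactors {J : Ideal R | J ∣ I} (T : Set (Multiset (Ideal R))) := by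
    intro J hJ
    have hJ0 : J ≠ 0 := ne_zero_of_dvd_ne_zero hI hJ
    simpa [T] using (dvd_iff_normalizedFactors_le_normalizedFactors hJ0 hI).1 hJ
  have hinj : Set.InjOn normalizedFactors {J : Ideal R | J ∣ I} := by
    intro J hJ J' hJ' h
    have hJ0 : J ≠ 0 := ne_zero_of_dvd_ne_zero hI hJ
    have hJ0' : J' ≠ 0 := ne_zero_of_dvd_ne_zero hI hJ'
    exact associated_iff_eq.1
      ((associated_iff_normalizedFactors_eq_normalizedFactors hJ0 hJ0').2 h)
  refine ⟨Set.Finite.of_injOn hmaps hinj T.finite_toSet, ?_⟩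
  refine (Set.ncard_le_ncard_of_injOn _ hmaps hinj T.finite_toSet).trans ?_
  rw [Set.ncard_coe_finset]
  -- A submultiset of `s` is determined by its multiplicities at the members of `s`.
  let g : Multiset (Ideal R) → (P : Ideal R) → P ∈ s.toFinset → ℕ := fun m P _ => m.count P
  have : T.card ≤ (s.toFinset.pi fun P => Finset.range (s.count P + 1)).card := by
    refine Finset.card_le_card_of_injOn g ?_ ?_
    · intro m hm
      have hm' : m ≤ s := by simpa [T] using hm
      simp only [Finset.mem_coe, Finset.mem_pi, Finset.mem_range, g]
      intro P _
      exact Nat.lt_succ_of_le (Multiset.count_le_of_le P hm')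
    · intro m hm m' hm' h
      have hm : m ≤ s := by simpa [T] using hm
      have hm' : m' ≤ s := by simpa [T] using hm'
      ext P
      by_cases hP : P ∈ s
      · exact congr_fun (congr_fun h P) (by simpa using hP)
      · rw [Multiset.count_eq_zero.2 fun h => hP (Multiset.mem_of_le hm h),
          Multiset.count_eq_zero.2 fun h => hP (Multiset.mem_of_le hm' h)]
  refine this.trans ?_
  rw [Finset.card_pi]
  simp

end DedekindDomain

/-- The divisor bound for ideals of a number field. -/
theorem exists_ncard_ideal_dvd_le (K : Type*) [Field K] [NumberField K] {δ : ℝ} (hδ : 0 < δ) :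
    ∃ C : ℝ, 0 < C ∧ ∀ I : Ideal (𝓞 K), I ≠ 0 →
      ({J : Ideal (𝓞 K) | J ∣ I}.ncard : ℝ) ≤ C * (absNorm I : ℝ) ^ δ := by
  classical
  set c : ℝ := 1 + (δ * Real.log 2)⁻¹ with hc
  have hl : 0 < Real.log 2 := Real.log_pos (by norm_num)
  have hc1 : 1 ≤ c := by
    have : 0 ≤ (δ * Real.log 2)⁻¹ := by positivity
    linarith
  -- Outside this finite set, which does not depend on `I`, `N(P) ^ δ ≥ 2` and the factor at `P`
  -- costs no constant.
  have hfin : {P : Ideal (𝓞 K) | absNorm P ≤ ⌈(2 : ℝ) ^ δ⁻¹⌉₊}.Finite :=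
    finite_setOfPred_absNorm_le _
  set S := hfin.toFinset
  refine ⟨c ^ S.card, by positivity, fun I hI => ?_⟩
  set s := normalizedFactors I with hs
  have hnorm : (absNorm I : ℝ) ^ δ = ∏ P ∈ s.toFinset, ((absNorm P : ℝ) ^ δ) ^ s.count P := by
    have h1 : I = s.prod := (associated_iff_eq.1 (prod_normalizedFactors hI)).symm
    conv_lhs => rw [h1, map_multiset_prod, Finset.prod_multiset_map_count]
    push_cast
    rw [← Real.finsetProd_rpow _ _ (fun _ _ => by positivity)]
    refine Finset.prod_congr rfl fun P _ => ?_
    rw [← Real.rpow_natCast, ← Real.rpow_natCast, ← Real.rpow_mul (by positivity),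
      ← Real.rpow_mul (by positivity), mul_comm]
  have hterm : ∀ P ∈ s.toFinset, ((s.count P + 1 : ℕ) : ℝ) ≤
      (if P ∈ S then c else 1) * ((absNorm P : ℝ) ^ δ) ^ s.count P := by
    intro P hP
    have hPs : P ∈ s := by simpa using hP
    have hprime : Prime P := prime_of_normalized_factor P hPs
    have hP2 : 2 ≤ absNorm P := by
      have h0 : absNorm P ≠ 0 := by
        rw [Ne, absNorm_eq_zero_iff]
        exact hprime.ne_zero
      have h1 : absNorm P ≠ 1 := by
        rw [Ne, absNorm_eq_one_iff]
        exact fun h => hprime.not_isUnit (isUnit_iff.2 h)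
      omega
    push_cast
    split_ifs with h
    · exact add_one_le_mul_rpow hδ (by exact_mod_cast hP2) _
    · rw [one_mul]
      refine add_one_le_pow_of_two_le ?_ _
      have h' : ⌈(2 : ℝ) ^ δ⁻¹⌉₊ < absNorm P := by simpa [S] using h
      have h2 : (2 : ℝ) ^ δ⁻¹ ≤ absNorm P := (Nat.le_ceil _).trans (by exact_mod_cast h'.le)
      calc (2 : ℝ) = ((2 : ℝ) ^ δ⁻¹) ^ δ := by
            rw [← Real.rpow_mul (by norm_num), inv_mul_cancel₀ hδ.ne', Real.rpow_one]
        _ ≤ _ := Real.rpow_le_rpow (by positivity) h2 hδ.le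
  calc ({J : Ideal (𝓞 K) | J ∣ I}.ncard : ℝ)
      ≤ ((∏ P ∈ s.toFinset, (s.count P + 1) : ℕ) : ℝ) := by
        exact_mod_cast (ncard_dvd_le_prod hI).2
    _ = ∏ P ∈ s.toFinset, ((s.count P + 1 : ℕ) : ℝ) := by push_cast; rfl
    _ ≤ ∏ P ∈ s.toFinset, ((if P ∈ S then c else 1) * ((absNorm P : ℝ) ^ δ) ^ s.count P) :=
        Finset.prod_le_prod (fun _ _ => by positivity) hterm
    _ = (∏ P ∈ s.toFinset, (if P ∈ S then c else 1)) * (absNorm I : ℝ) ^ δ := by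
        rw [Finset.prod_mul_distrib, hnorm]
    _ ≤ c ^ S.card * (absNorm I : ℝ) ^ δ := by
        gcongr
        rw [Finset.prod_ite, Finset.prod_const, Finset.prod_const_one, mul_one]
        refine pow_le_pow_right₀ hc1 (Finset.card_le_card fun P hP => ?_)
        exact (Finset.mem_filter.1 hP).2

end CubicSquares

namespace CubicSquares

/-! ### Counting units of bounded height -/

open NumberField NumberField.Units NumberField.Units.dirichletUnitTheorem Module

/-- The number of integers of absolute value at most `x`. -/
theorem card_Icc_neg_floor_le {x : ℝ} (hx : 0 ≤ x) :
    ((Finset.Icc (-⌊x⌋) ⌊x⌋).card : ℝ) ≤ 2 * x + 1 := by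
  have h0 : 0 ≤ ⌊x⌋ := Int.floor_nonneg.2 hx
  have h : ((Finset.Icc (-⌊x⌋) ⌊x⌋).card : ℤ) = 2 * ⌊x⌋ + 1 := by
    rw [Int.card_Icc, Int.toNat_of_nonneg (by omega)]
    ring
  have h' : ((Finset.Icc (-⌊x⌋) ⌊x⌋).card : ℝ) = 2 * ⌊x⌋ + 1 := by exact_mod_cast h
  rw [h']
  linarith [Int.floor_le x]

/-- Units with bounded logarithms are at most `C B ^ rank` in number. -/
theorem exists_ncard_units_le (K : Type*) [Field K] [NumberField K] :
    ∃ C : ℝ, 0 < C ∧ ∀ B : ℝ, 1 ≤ B →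
      {u : (𝓞 K)ˣ | ∀ w : InfinitePlace K, |Real.log (w (u : K))| ≤ B}.Finite ∧
      ({u : (𝓞 K)ˣ | ∀ w : InfinitePlace K, |Real.log (w (u : K))| ≤ B}.ncard : ℝ) ≤
        C * B ^ rank K := by
  classical
  have : Fintype (torsion K) := Fintype.ofFinite _
  choose f hf _ using exist_unique_eq_mul_prod K
  -- `φ` reads off the exponents of a unit in the fundamental system. It is continuous, so bounded
  -- logarithms force bounded exponents.
  let b : Basis (Fin (rank K)) ℝ (logSpace K) := (basisUnitLattice K).ofZLatticeBasis ℝ _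
  let φ : logSpace K →L[ℝ] (Fin (rank K) → ℝ) := b.equivFun.toLinearMap.toContinuousLinearMap
  have hφ : ∀ u i, φ (logEmbedding K (Additive.ofMul u)) i = (f u).2 i := by
    intro u i
    have hlog : logEmbedding K (Additive.ofMul u) = ∑ j, ((f u).2 j : ℝ) • b j := by
      conv_lhs => rw [hf u]
      rw [ofMul_mul, map_add, logEmbedding_eq_zero_iff.2 (f u).1.2, zero_add, ofMul_prod, map_sum]
      refine Finset.sum_congr rfl fun j _ => ?_
      rw [ofMul_zpow, map_zsmul, logEmbedding_fundSystem, Basis.ofZLatticeBasis_apply,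
        Int.cast_smul_eq_zsmul]
    rw [hlog]
    change b.equivFun (∑ j, ((f u).2 j : ℝ) • b j) i = _
    rw [← b.equivFun_symm_apply, LinearEquiv.apply_symm_apply]
  -- The factor `2` bounds the multiplicities of the places in `logEmbedding`.
  set D : ℝ := 2 * ‖φ‖
  have hD : 0 ≤ D := by positivity
  refine ⟨Nat.card (torsion K) * (2 * D + 1) ^ rank K, ?_, fun B hB => ?_⟩
  · have : 0 < Nat.card (torsion K) := Nat.card_pos
    positivity
  set U := {u : (𝓞 K)ˣ | ∀ w : InfinitePlace K, |Real.log (w (u : K))| ≤ B}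
  have hbound : ∀ u ∈ U, ∀ i, |((f u).2 i : ℝ)| ≤ D * B := by
    intro u hu i
    rw [← hφ, ← Real.norm_eq_abs]
    refine (norm_le_pi_norm _ i).trans ((φ.le_opNorm _).trans ?_)
    have : ‖logEmbedding K (Additive.ofMul u)‖ ≤ 2 * B := by
      refine (pi_norm_le_iff_of_nonneg (by linarith)).2 fun w => ?_
      rw [logEmbedding_component, norm_mul, Real.norm_eq_abs, Real.norm_eq_abs]
      refine mul_le_mul ?_ (hu w) (abs_nonneg _) (by norm_num)
      rw [InfinitePlace.mult]
      split_ifs <;> norm_num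
    calc ‖φ‖ * ‖logEmbedding K (Additive.ofMul u)‖ ≤ ‖φ‖ * (2 * B) := by gcongr
      _ = D * B := by ring
  let T : Finset (torsion K × (Fin (rank K) → ℤ)) :=
    Finset.univ ×ˢ Fintype.piFinset fun _ => Finset.Icc (-⌊D * B⌋) ⌊D * B⌋
  have hmaps : Set.MapsTo f U (T : Set (torsion K × (Fin (rank K) → ℤ))) := by
    intro u hu
    simp only [T, Finset.coe_product, Set.mem_prod, Finset.mem_coe, Finset.mem_univ, true_and,
      Fintype.mem_piFinset, Finset.mem_Icc]
    intro i
    have := abs_le.1 (hbound u hu i)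
    refine ⟨?_, Int.le_floor.2 this.2⟩
    rw [neg_le]
    refine Int.le_floor.2 ?_
    push_cast
    linarith
  have hinj : Set.InjOn f U := fun u _ v _ h => by rw [hf u, hf v, h]
  refine ⟨Set.Finite.of_injOn hmaps hinj T.finite_toSet, ?_⟩
  have hcard := Set.ncard_le_ncard_of_injOn _ hmaps hinj T.finite_toSet
  rw [Set.ncard_coe_finset, Finset.card_product, Fintype.card_piFinset, Finset.prod_const,
    Finset.card_univ, Finset.card_univ, Fintype.card_fin, ← Nat.card_eq_fintype_card] at hcard
  calc (U.ncard : ℝ)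
      ≤ Nat.card (torsion K) * ((Finset.Icc (-⌊D * B⌋) ⌊D * B⌋).card : ℝ) ^ rank K := by
        exact_mod_cast hcard
    _ ≤ Nat.card (torsion K) * ((2 * D + 1) * B) ^ rank K := by
        refine mul_le_mul_of_nonneg_left (pow_le_pow_left₀ (Nat.cast_nonneg _) ?_ _)
          (Nat.cast_nonneg _)
        refine (card_Icc_neg_floor_le (mul_nonneg hD (by linarith))).trans ?_
        nlinarith
    _ = _ := by rw [mul_pow]; ring

end CubicSquares

namespace CubicSquares

/-! ### Counting generators and divisors with bounded conjugates -/

open NumberField NumberField.Units Module Ideal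

/-- A set whose image is finite and whose fibres have at most `M` elements. -/
theorem finite_and_ncard_le_mul {α β : Type*} {S : Set α} {E : Set β} (f : α → β) (hE : E.Finite)
    (hf : Set.MapsTo f S E) {M : ℝ} (hM0 : 0 ≤ M)
    (hM : ∀ b ∈ E, {a ∈ S | f a = b}.Finite ∧ ({a ∈ S | f a = b}.ncard : ℝ) ≤ M) :
    S.Finite ∧ (S.ncard : ℝ) ≤ M * E.ncard := by
  classical
  have hS : S.Finite := (hE.biUnion fun b hb => (hM b hb).1).subset fun a ha =>
    Set.mem_biUnion (hf ha) ⟨ha, rfl⟩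
  refine ⟨hS, ?_⟩
  have h := Finset.card_le_mul_card_image_of_maps_to (s := hS.toFinset) (t := hE.toFinset)
    (f := f) (fun a ha => by simpa using hf (by simpa using ha)) ⌊M⌋₊ fun b hb => by
      have hb' : b ∈ E := by simpa using hb
      refine Nat.le_floor ((le_of_eq ?_).trans (hM b hb').2)
      rw [← Set.ncard_coe_finset]
      congr 2
      ext a
      simp
  rw [← Set.ncard_eq_toFinset_card _ hS, ← Set.ncard_eq_toFinset_card _ hE] at h
  calc (S.ncard : ℝ) ≤ ⌊M⌋₊ * E.ncard := by exact_mod_cast h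
    _ ≤ M * E.ncard := by
      gcongr
      exact Nat.floor_le hM0

section NumberField

variable (K : Type*) [Field K] [NumberField K]

/-- A nonzero algebraic integer all of whose conjugates are small has no very small conjugate. -/
theorem sub_log_le_of_forall_le {T : ℝ} {z : 𝓞 K} (hz : z ≠ 0)
    (h : ∀ w : InfinitePlace K, w (z : K) ≤ Real.exp T) (w : InfinitePlace K) :
    0 ≤ T - Real.log (w (z : K)) ∧ T - Real.log (w (z : K)) ≤ finrank ℚ K * T := by
  have hzK : (z : K) ≠ 0 := by simpa using hz
  have hpos : ∀ v : InfinitePlace K, 0 < v (z : K) := fun v => InfinitePlace.pos_iff.2 hzK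
  have hnn : ∀ v : InfinitePlace K, 0 ≤ T - Real.log (v (z : K)) := fun v =>
    sub_nonneg.2 ((Real.log_le_iff_le_exp (hpos v)).2 (h v))
  refine ⟨hnn w, ?_⟩
  have hnorm : (1 : ℝ) ≤ |Algebra.norm ℚ (z : K)| := by
    rw [← Algebra.coe_norm_int, ← Int.cast_one, ← Int.cast_abs, Rat.cast_intCast, Int.cast_le]
    exact Int.one_le_abs (Algebra.norm_ne_zero_iff.mpr hz)
  have hsum : 0 ≤ ∑ v : InfinitePlace K, (v.mult : ℝ) * Real.log (v (z : K)) := by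
    have := Real.log_nonneg hnorm
    rw [← InfinitePlace.prod_eq_abs_norm,
      Real.log_prod (fun v _ => pow_ne_zero _ (hpos v).ne')] at this
    simpa [Real.log_pow] using this
  have hmult : ∑ v : InfinitePlace K, (v.mult : ℝ) = finrank ℚ K := by
    exact_mod_cast InfinitePlace.sum_mult_eq
  have h1 : (1 : ℝ) ≤ w.mult := by exact_mod_cast InfinitePlace.mult_pos
  -- All terms `T - log (v z)` are nonnegative, so one of them is at most their weighted sum, which
  -- the norm bound keeps below `d T`.
  calc T - Real.log (w (z : K)) ≤ w.mult * (T - Real.log (w (z : K))) :=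
        le_mul_of_one_le_left (hnn w) h1
    _ ≤ ∑ v : InfinitePlace K, (v.mult : ℝ) * (T - Real.log (v (z : K))) :=
        Finset.single_le_sum (f := fun v : InfinitePlace K =>
          (v.mult : ℝ) * (T - Real.log (v (z : K))))
          (fun v _ => mul_nonneg (Nat.cast_nonneg _) (hnn v)) (Finset.mem_univ w)
    _ = finrank ℚ K * T - ∑ v : InfinitePlace K, (v.mult : ℝ) * Real.log (v (z : K)) := by
        rw [← hmult, Finset.sum_mul, ← Finset.sum_sub_distrib]
        exact Finset.sum_congr rfl fun _ _ => mul_sub _ _ _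
    _ ≤ _ := by linarith

/-- The number of generators of an ideal with conjugates at most `exp T`. -/
theorem exists_ncard_generators_le :
    ∃ C : ℝ, 0 < C ∧ ∀ T : ℝ, 1 ≤ T → ∀ I : Ideal (𝓞 K), I ≠ 0 →
      {z : 𝓞 K | span {z} = I ∧ ∀ w : InfinitePlace K, w (z : K) ≤ Real.exp T}.Finite ∧
      ({z : 𝓞 K | span {z} = I ∧ ∀ w : InfinitePlace K, w (z : K) ≤ Real.exp T}.ncard : ℝ) ≤
        C * T ^ rank K := by
  obtain ⟨C, hC, hU⟩ := exists_ncard_units_le K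
  have hd : (1 : ℝ) ≤ finrank ℚ K := by exact_mod_cast Module.finrank_pos (R := ℚ) (M := K)
  have hd0 : (0 : ℝ) < finrank ℚ K := by linarith
  refine ⟨C * (finrank ℚ K : ℝ) ^ rank K, mul_pos hC (pow_pos hd0 _), fun T hT I hI => ?_⟩
  set S := {z : 𝓞 K | span {z} = I ∧ ∀ w : InfinitePlace K, w (z : K) ≤ Real.exp T}
  rcases S.eq_empty_or_nonempty with hS | ⟨z₀, hz₀⟩
  · rw [hS]
    refine ⟨Set.finite_empty, ?_⟩
    rw [Set.ncard_empty, Nat.cast_zero]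
    exact mul_nonneg (mul_pos hC (pow_pos hd0 _)).le (pow_nonneg (by linarith) _)
  have hne : ∀ z ∈ S, z ≠ 0 := by
    rintro z hz rfl
    exact hI (by simpa using hz.1.symm)
  obtain ⟨hfin, hcard⟩ := hU (finrank ℚ K * T) (by nlinarith)
  set U := {u : (𝓞 K)ˣ | ∀ w : InfinitePlace K, |Real.log (w (u : K))| ≤ finrank ℚ K * T}
  -- Both generators have logarithms in `[T - d T, T]`, so those of their quotient are at most `d T`
  -- in absolute value.
  have hsub : S ⊆ (fun u : (𝓞 K)ˣ => z₀ * u) '' U := by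
    intro z hz
    obtain ⟨u, hu⟩ : Associated z₀ z := span_singleton_eq_span_singleton.1 (hz₀.1.trans hz.1.symm)
    refine ⟨u, fun w => ?_, hu⟩
    have h0 := sub_log_le_of_forall_le K (hne z₀ hz₀) hz₀.2 w
    have h1 := sub_log_le_of_forall_le K (hne z hz) hz.2 w
    have hpos : 0 < w (z₀ : K) := InfinitePlace.pos_iff.2 (by simpa using hne z₀ hz₀)
    have hlog : Real.log (w (z : K)) = Real.log (w (z₀ : K)) + Real.log (w (u : K)) := by
      rw [← hu, show ((z₀ * u : 𝓞 K) : K) = z₀ * (u : K) from map_mul (algebraMap (𝓞 K) K) _ _,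
        map_mul, Real.log_mul hpos.ne' (Units.pos_at_place u w).ne']
    rw [abs_le]
    constructor <;> linarith [h0.1, h0.2, h1.1, h1.2]
  refine ⟨(hfin.image _).subset hsub, ?_⟩
  calc (S.ncard : ℝ) ≤ U.ncard := by
        exact_mod_cast (Set.ncard_le_ncard hsub (hfin.image _)).trans (Set.ncard_image_le hfin)
    _ ≤ C * (finrank ℚ K * T) ^ rank K := hcard
    _ = _ := by rw [mul_pow, mul_assoc]

/-- The number of divisors of `m` with conjugates at most `exp T`. -/
theorem exists_ncard_dvd_le {δ : ℝ} (hδ : 0 < δ) :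
    ∃ C : ℝ, 0 < C ∧ ∀ T : ℝ, 1 ≤ T → ∀ m : 𝓞 K, m ≠ 0 →
      {z : 𝓞 K | z ∣ m ∧ ∀ w : InfinitePlace K, w (z : K) ≤ Real.exp T}.Finite ∧
      ({z : 𝓞 K | z ∣ m ∧ ∀ w : InfinitePlace K, w (z : K) ≤ Real.exp T}.ncard : ℝ) ≤
        C * (absNorm (span {m}) : ℝ) ^ δ * T ^ rank K := by
  obtain ⟨C₁, hC₁, h₁⟩ := exists_ncard_ideal_dvd_le K hδ
  obtain ⟨C₂, hC₂, h₂⟩ := exists_ncard_generators_le K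
  refine ⟨C₂ * C₁, mul_pos hC₂ hC₁, fun T hT m hm => ?_⟩
  have hm' : span {m} ≠ 0 := by simpa using hm
  have hT' : 0 ≤ C₂ * T ^ rank K := mul_nonneg hC₂.le (pow_nonneg (by linarith) _)
  obtain ⟨hfin, hcard⟩ := finite_and_ncard_le_mul
    (S := {z : 𝓞 K | z ∣ m ∧ ∀ w : InfinitePlace K, w (z : K) ≤ Real.exp T})
    (fun z => span {z}) (ncard_dvd_le_prod hm').1
    (fun z hz => Ideal.dvd_iff_le.2 (span_singleton_le_span_singleton.2 hz.1))
    hT' (fun I hI => by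
      obtain ⟨hf, hc⟩ := h₂ T hT I (ne_zero_of_dvd_ne_zero hm' hI)
      have hsub : {z ∈ {z : 𝓞 K | z ∣ m ∧ ∀ w : InfinitePlace K, w (z : K) ≤ Real.exp T} |
          span {z} = I} ⊆
          {z : 𝓞 K | span {z} = I ∧ ∀ w : InfinitePlace K, w (z : K) ≤ Real.exp T} :=
        fun z hz => ⟨hz.2, hz.1.2⟩
      exact ⟨hf.subset hsub, le_trans (by exact_mod_cast Set.ncard_le_ncard hsub hf) hc⟩)
  refine ⟨hfin, hcard.trans ?_⟩
  calc _ ≤ C₂ * T ^ rank K * (C₁ * (absNorm (span {m}) : ℝ) ^ δ) :=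
        mul_le_mul_of_nonneg_left (h₁ _ hm') hT'
    _ = _ := by ring

/-- A field that contains a square root of `-1` is totally complex. -/
theorem isTotallyComplex_of_sq_eq_neg_one {K : Type*} [Field K] {j : K} (hj : j ^ 2 = -1) :
    IsTotallyComplex K where
  isComplex w := by
    rw [← InfinitePlace.not_isReal_iff_isComplex]
    intro hw
    have h := InfinitePlace.embedding_of_isReal_apply hw j
    have h2 : ((InfinitePlace.embedding_of_isReal hw j : ℝ) : ℂ) ^ 2 = -1 := by
      rw [h, ← map_pow, hj, map_neg, map_one]
    have h3 : (InfinitePlace.embedding_of_isReal hw j) ^ 2 = (-1 : ℝ) := by exact_mod_cast h2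
    nlinarith [sq_nonneg (InfinitePlace.embedding_of_isReal hw j)]

/-- Each complex place contributes `2` to the degree, so there are at most three places; the rank is
one less. -/
theorem rank_le_two [IsTotallyComplex K] (h : finrank ℚ K ≤ 6) : rank K ≤ 2 := by
  have h1 := IsTotallyComplex.finrank K
  have h2 := InfinitePlace.card_eq_nrRealPlaces_add_nrComplexPlaces K
  have h3 := IsTotallyComplex.nrRealPlaces_eq_zero K
  rw [rank]
  omega

end NumberField

end CubicSquares

namespace CubicSquares

/-! ### Representations of a fixed integer -/

open NumberField NumberField.Units Module Ideal IntermediateField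

/-- The conjugates of `a₀ + a₁ t + a₂ t² + j (b₀ + b₁ t + b₂ t²)` are `O(Y)` if the coefficients
are at most `Y`. -/
theorem place_le_of_coeff_le {K : Type*} [Field K] (w : InfinitePlace K) (t j : K) {a b : Fin 3 → ℤ} {Y : ℝ}
    (ha : ∀ i, |(a i : ℝ)| ≤ Y) (hb : ∀ i, |(b i : ℝ)| ≤ Y) :
    w (a 0 + a 1 * t + a 2 * t ^ 2 + j * (b 0 + b 1 * t + b 2 * t ^ 2)) ≤
      (1 + w t + w t ^ 2) * (1 + w j) * Y := by
  have hint : ∀ n : ℤ, w (n : K) = |(n : ℝ)| := fun n => by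
    rw [← InfinitePlace.norm_embedding_eq, map_intCast, Complex.norm_intCast]
  have hadd : ∀ x y : K, w (x + y) ≤ w x + w y := fun x y => w.1.add_le x y
  have ht : 0 ≤ w t := apply_nonneg w t
  have hj : 0 ≤ w j := apply_nonneg w j
  have key : ∀ c : Fin 3 → ℤ, (∀ i, |(c i : ℝ)| ≤ Y) →
      w (c 0 + c 1 * t + c 2 * t ^ 2) ≤ (1 + w t + w t ^ 2) * Y := by
    intro c hc
    calc w (c 0 + c 1 * t + c 2 * t ^ 2) ≤ w (c 0 : K) + w (c 1 * t) + w (c 2 * t ^ 2) :=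
          (hadd _ _).trans (add_le_add_left (hadd _ _) _)
      _ = |(c 0 : ℝ)| + |(c 1 : ℝ)| * w t + |(c 2 : ℝ)| * w t ^ 2 := by
          rw [map_mul, map_mul, map_pow, hint, hint, hint]
      _ ≤ Y + Y * w t + Y * w t ^ 2 := by gcongr <;> exact hc _
      _ = _ := by ring
  calc _ ≤ w (a 0 + a 1 * t + a 2 * t ^ 2) + w j * w (b 0 + b 1 * t + b 2 * t ^ 2) :=
        (hadd _ _).trans_eq (by rw [map_mul])
    _ ≤ (1 + w t + w t ^ 2) * Y + w j * ((1 + w t + w t ^ 2) * Y) := by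
        gcongr
        · exact key a ha
        · exact key b hb
    _ = _ := by ring

/-- The norm of an element with conjugates at most `X` is at most `X ^ d`. -/
theorem absNorm_span_le {K : Type*} [Field K] [NumberField K] {m : 𝓞 K} {X : ℝ} (h : ∀ w : InfinitePlace K, w (m : K) ≤ X) :
    (absNorm (span {m}) : ℝ) ≤ X ^ finrank ℚ K := by
  have h1 : (absNorm (span {m}) : ℝ) = |((Algebra.norm ℚ (m : K) : ℚ) : ℝ)| := by
    rw [absNorm_span_singleton, ← Algebra.coe_norm_int, Nat.cast_natAbs, Int.cast_abs,
      Rat.cast_intCast]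
  rw [h1, ← Rat.cast_abs, ← InfinitePlace.prod_eq_abs_norm, ← InfinitePlace.sum_mult_eq,
    ← Finset.prod_pow_eq_pow_sum]
  exact Finset.prod_le_prod (fun w _ => pow_nonneg (apply_nonneg _ _) _)
    fun w _ => pow_le_pow_left₀ (apply_nonneg _ _) (h w) _

/-- The pairs of `setR` that belong to a given integer `n`. -/
def fibre (θ : ℝ) (q : ℕ) (Y : ℝ) (n : ℤ) : Set (ℝ × ℝ) :=
  {ω | ω.1 ∈ Zring θ ∧ ω.2 ∈ Zring θ ∧ (maxCoeff θ ω.1 : ℝ) ≤ Y ∧ (maxCoeff θ ω.2 : ℝ) ≤ Y ∧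
    ω.1 ^ 2 + ω.2 ^ 2 = (q : ℝ) ^ 2 * ((n : ℝ) - θ)}

theorem exists_coeffs_le {θ : ℝ} (hint : IsIntegral ℤ θ) (hdeg : (minpoly ℚ θ).natDegree = 3)
    {x Y : ℝ} (hx : x ∈ Zring θ) (hY : (maxCoeff θ x : ℝ) ≤ Y) :
    ∃ c : Fin 3 → ℤ, x = c 0 + c 1 * θ + c 2 * θ ^ 2 ∧ ∀ i, |(c i : ℝ)| ≤ Y := by
  obtain ⟨c₀, c₁, c₂, rfl⟩ := exists_coeffs hint hdeg hx
  rw [maxCoeff_eq hdeg] at hY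
  refine ⟨![c₀, c₁, c₂], by simp, fun i => le_trans ?_ hY⟩
  rw [← Int.cast_abs, Int.abs_eq_natAbs, Int.cast_natCast, Nat.cast_le]
  fin_cases i <;> simp

theorem sub_ne_zero_of_natDegree {θ : ℝ} (hdeg : (minpoly ℚ θ).natDegree = 3) (n : ℤ) :
    (n : ℝ) - θ ≠ 0 := by
  intro h
  have := coeffs_unique hdeg (a₀ := n) (a₁ := 0) (a₂ := 0) (b₀ := 0) (b₁ := 1) (b₂ := 0)
    (by push_cast; linarith)
  omega

/-- Only integral copies `t`, `j` of `θ`, `i` and the rank bound matter, so the construction of the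
field is kept apart. -/
theorem exists_ncard_fibre_le_of_field {K : Type*} [Field K] [NumberField K] (φ : K →+* ℂ)
    (t j : 𝓞 K) {θ : ℝ} (ht : φ t = θ) (hj : φ j = Complex.I) (hrank : rank K ≤ 2)
    (hint : IsIntegral ℤ θ) (hdeg : (minpoly ℚ θ).natDegree = 3) {q : ℕ} (hq : q ≠ 0)
    {ε : ℝ} (hε : 0 < ε) :
    ∃ C : ℝ, 0 < C ∧ ∀ Y₁ Y₂ : ℝ, 2 ≤ Y₁ → 2 ≤ Y₂ → ∀ n : ℤ, |(n : ℝ)| ≤ Y₂ →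
      (fibre θ q Y₁ n).Finite ∧
      ((fibre θ q Y₁ n).ncard : ℝ) ≤ C * Y₂ ^ ε * Real.log Y₁ ^ 2 := by
  have hφ : Function.Injective φ := φ.injective
  have hd : (0 : ℝ) < finrank ℚ K := by exact_mod_cast Module.finrank_pos (R := ℚ) (M := K)
  -- The exponent `ε / d` cancels the `d` in `N(m) = O(Y₂ ^ d)`.
  obtain ⟨C, hC, hdvd⟩ := exists_ncard_dvd_le K (div_pos hε hd)
  -- The sum serves all places at once; the leading `1` makes `log A ≥ 0`.
  set A : ℝ := 1 + ∑ w : InfinitePlace K,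
    (1 + w (t : K) + w (t : K) ^ 2) * (1 + w (j : K)) with hA
  have hterm : ∀ w : InfinitePlace K, 0 ≤ (1 + w (t : K) + w (t : K) ^ 2) * (1 + w (j : K)) := by
    intro w
    have := apply_nonneg w (t : K)
    have := apply_nonneg w (j : K)
    positivity
  have hA1 : 1 ≤ A := le_add_of_nonneg_right (Finset.sum_nonneg fun w _ => hterm w)
  have hAw : ∀ w : InfinitePlace K, (1 + w (t : K) + w (t : K) ^ 2) * (1 + w (j : K)) ≤ A := by
    intro w
    have := Finset.single_le_sum (fun w _ => hterm w) (Finset.mem_univ w)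
    linarith
  have hlog2 : 0 < Real.log 2 := Real.log_pos (by norm_num)
  -- Since `log Y₁ ≥ log 2`, this gives `c log Y₁ ≥ 1 + log A + log Y₁`, hence both `T ≥ 1` and `exp
  -- T ≥ A Y₁`.
  set c : ℝ := 1 + (1 + Real.log A) / Real.log 2 with hc
  have hlA : 0 ≤ Real.log A := Real.log_nonneg hA1
  have hc0 : 0 < c := by positivity
  set B : ℝ := (q : ℝ) ^ 2 * A with hB
  have hq0 : (0 : ℝ) < q := by exact_mod_cast Nat.pos_of_ne_zero hq
  have hB0 : 0 < B := by positivity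
  refine ⟨C * B ^ ε * c ^ 2, by positivity, fun Y₁ Y₂ hY₁ hY₂ n hn => ?_⟩
  set T : ℝ := c * Real.log Y₁ with hT
  have hlogY : Real.log 2 ≤ Real.log Y₁ := Real.log_le_log (by norm_num) hY₁
  have hTle : 1 + Real.log A + Real.log Y₁ ≤ T := by
    have : 1 + Real.log A ≤ (1 + Real.log A) / Real.log 2 * Real.log Y₁ := by
      rw [div_mul_eq_mul_div, le_div_iff₀ hlog2]
      gcongr
    rw [hT, hc]
    linarith
  have hT1 : 1 ≤ T := by linarith
  have hexp : A * Y₁ ≤ Real.exp T := by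
    rw [← Real.log_le_iff_le_exp (by positivity), Real.log_mul (by positivity) (by positivity)]
    linarith
  set m : 𝓞 K := (q : 𝓞 K) ^ 2 * ((n : 𝓞 K) - t) with hm
  have hφm : φ m = (q : ℂ) ^ 2 * (n - θ) := by
    simp [hm, ht]
  have hm0 : m ≠ 0 := by
    intro h
    rw [h] at hφm
    have h1 : ((0 : ℝ) : ℂ) = (((q : ℝ) ^ 2 * ((n : ℝ) - θ) : ℝ) : ℂ) := by
      push_cast
      simpa using hφm
    exact mul_ne_zero (by positivity) (sub_ne_zero_of_natDegree hdeg n)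
      (Complex.ofReal_injective h1).symm
  have hmw : ∀ w : InfinitePlace K, w (m : K) ≤ B * Y₂ := by
    intro w
    have hmK : (m : K) = (q : K) ^ 2 * ((n : K) - t) := by simp [hm]
    have hwq : w (q : K) = q := by
      rw [← InfinitePlace.norm_embedding_eq, map_natCast, Complex.norm_natCast]
    have hwn : w (n : K) = |(n : ℝ)| := by
      rw [← InfinitePlace.norm_embedding_eq, map_intCast, Complex.norm_intCast]
    have h1 : w ((n : K) - t) ≤ Y₂ + w (t : K) :=
      calc w ((n : K) - t) ≤ w (n : K) + w (t : K) := by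
            simp only [← InfinitePlace.norm_embedding_eq, map_sub]
            exact norm_sub_le _ _
        _ ≤ Y₂ + w (t : K) := by rw [hwn]; linarith
    have ht0 := apply_nonneg w (t : K)
    have hj0 := apply_nonneg w (j : K)
    have h2 : 1 + w (t : K) ≤ A := by
      refine le_trans ?_ (hAw w)
      nlinarith [mul_nonneg ht0 hj0, mul_nonneg (sq_nonneg (w (t : K))) hj0]
    rw [hmK, map_mul, map_pow, hwq, hB, mul_assoc]
    refine mul_le_mul_of_nonneg_left ?_ (by positivity)
    nlinarith
  have hnorm : (absNorm (span {m}) : ℝ) ^ (ε / finrank ℚ K) ≤ B ^ ε * Y₂ ^ ε := by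
    calc _ ≤ ((B * Y₂) ^ finrank ℚ K : ℝ) ^ (ε / finrank ℚ K) :=
          Real.rpow_le_rpow (by positivity) (absNorm_span_le hmw) (by positivity)
      _ = (B * Y₂) ^ ε := by
          rw [← Real.rpow_natCast, ← Real.rpow_mul (by positivity), mul_div_cancel₀ _ hd.ne']
      _ = _ := Real.mul_rpow (by positivity) (by positivity)
  have hex : ∀ ω ∈ fibre θ q Y₁ n, ∃ z : 𝓞 K, φ z = ω.1 + ω.2 * Complex.I ∧ z ∣ m ∧
      ∀ w : InfinitePlace K, w (z : K) ≤ Real.exp T := by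
    rintro ⟨x, y⟩ ⟨hx, hy, hxY, hyY, hxy⟩
    obtain ⟨a, ha, haY⟩ := exists_coeffs_le hint hdeg hx hxY
    obtain ⟨b, hb, hbY⟩ := exists_coeffs_le hint hdeg hy hyY
    set P : 𝓞 K := a 0 + a 1 * t + a 2 * t ^ 2 with hP
    set Q : 𝓞 K := b 0 + b 1 * t + b 2 * t ^ 2 with hQ
    have hx' : φ P = x := by
      have hC := congrArg (fun r : ℝ => (r : ℂ)) ha
      push_cast at hC
      simp [hP, ht, hC]
    have hy' : φ Q = y := by
      have hC := congrArg (fun r : ℝ => (r : ℂ)) hb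
      push_cast at hC
      simp [hQ, ht, hC]
    -- The cofactor of `P + j Q` in `m` is `P - j Q`.
    refine ⟨P + j * Q, ?_, ⟨P - j * Q, ?_⟩, fun w => ?_⟩
    · simp [hx', hy', hj, mul_comm]
    · refine RingOfIntegers.ext (hφ ?_)
      have hC := congrArg (fun r : ℝ => (r : ℂ)) hxy
      push_cast at hC
      rw [hφm, ← hC]
      simp only [map_mul, map_add, map_sub, hx', hy', hj]
      linear_combination (y : ℂ) ^ 2 * Complex.I_sq
    · have h := place_le_of_coeff_le w (t : K) (j : K) haY hbY
      refine le_trans (le_of_eq ?_) (h.trans (le_trans ?_ hexp))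
      · simp [hP, hQ]
      · exact mul_le_mul_of_nonneg_right (hAw w) (by linarith)
  choose! g hgφ hgm hgw using hex
  obtain ⟨hfin, hcard⟩ := hdvd T hT1 m hm0
  have hmaps : Set.MapsTo g (fibre θ q Y₁ n)
      {z : 𝓞 K | z ∣ m ∧ ∀ w : InfinitePlace K, w (z : K) ≤ Real.exp T} :=
    fun ω hω => ⟨hgm ω hω, hgw ω hω⟩
  -- Both coordinates are real, so they are the real and imaginary parts of the image under `φ`.
  have hinj : Set.InjOn g (fibre θ q Y₁ n) := by
    intro ω hω ω' hω' h
    have h1 := hgφ ω hω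
    rw [h, hgφ ω' hω'] at h1
    have hre := congrArg Complex.re h1
    have him := congrArg Complex.im h1
    simp only [Complex.add_re, Complex.add_im, Complex.mul_re, Complex.mul_im, Complex.ofReal_re,
      Complex.ofReal_im, Complex.I_re, Complex.I_im] at hre him
    exact Prod.ext (by linarith) (by linarith)
  refine ⟨Set.Finite.of_injOn hmaps hinj hfin, ?_⟩
  calc ((fibre θ q Y₁ n).ncard : ℝ)
      ≤ C * (absNorm (span {m}) : ℝ) ^ (ε / finrank ℚ K) * T ^ rank K :=
        le_trans (by exact_mod_cast Set.ncard_le_ncard_of_injOn g hmaps hinj hfin) hcard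
    _ ≤ C * (B ^ ε * Y₂ ^ ε) * T ^ 2 := by
        gcongr
    _ = _ := by
        rw [hT]
        ring

/-- The number of representations of `q² (n - θ)` as a sum of two squares. -/
theorem exists_ncard_fibre_le {θ : ℝ} (hint : IsIntegral ℤ θ)
    (hdeg : (minpoly ℚ θ).natDegree = 3) {q : ℕ} (hq : q ≠ 0) {ε : ℝ} (hε : 0 < ε) :
    ∃ C : ℝ, 0 < C ∧ ∀ Y₁ Y₂ : ℝ, 2 ≤ Y₁ → 2 ≤ Y₂ → ∀ n : ℤ, |(n : ℝ)| ≤ Y₂ →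
      (fibre θ q Y₁ n).Finite ∧
      ((fibre θ q Y₁ n).ncard : ℝ) ≤ C * Y₂ ^ ε * Real.log Y₁ ^ 2 := by
  have hθ : IsIntegral ℤ (θ : ℂ) := hint.map (Algebra.ofId ℝ ℂ |>.restrictScalars ℤ)
  have hI : IsIntegral ℤ Complex.I := by
    refine ⟨Polynomial.X ^ 2 + 1, by monicity!, by simp⟩
  have hθQ : IsIntegral ℚ (θ : ℂ) := hθ.tower_top
  have hIQ : IsIntegral ℚ Complex.I := hI.tower_top
  let K : IntermediateField ℚ ℂ := ℚ⟮(θ : ℂ)⟯ ⊔ ℚ⟮Complex.I⟯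
  have : FiniteDimensional ℚ ℚ⟮(θ : ℂ)⟯ := adjoin.finiteDimensional hθQ
  have : FiniteDimensional ℚ ℚ⟮Complex.I⟯ := adjoin.finiteDimensional hIQ
  have : FiniteDimensional ℚ K := finiteDimensional_sup _ _
  have : NumberField K := { to_charZero := inferInstance, to_finiteDimensional := this }
  have hmem : (θ : ℂ) ∈ K := (le_sup_left : ℚ⟮(θ : ℂ)⟯ ≤ K) (mem_adjoin_simple_self ℚ _)
  have hmemI : Complex.I ∈ K := (le_sup_right : ℚ⟮Complex.I⟯ ≤ K) (mem_adjoin_simple_self ℚ _)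
  have hinjK : Function.Injective (algebraMap K ℂ) := (algebraMap K ℂ).injective
  let t : 𝓞 K := ⟨⟨θ, hmem⟩, (isIntegral_algebraMap_iff hinjK).1 hθ⟩
  let j : 𝓞 K := ⟨⟨Complex.I, hmemI⟩, (isIntegral_algebraMap_iff hinjK).1 hI⟩
  have hrank : rank K ≤ 2 := by
    have : IsTotallyComplex K := isTotallyComplex_of_sq_eq_neg_one (j := (⟨Complex.I, hmemI⟩ : K))
      (Subtype.ext (by simp))
    -- The compositum has degree at most `3 * 2`.
    refine rank_le_two K ((finrank_sup_le _ _).trans ?_)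
    have h3 : finrank ℚ ℚ⟮(θ : ℂ)⟯ = 3 := by
      rw [adjoin.finrank hθQ, ← hdeg]
      exact congrArg _ (minpoly.algebraMap_eq (A := ℚ) (B := ℝ) (B' := ℂ)
        Complex.ofReal_injective θ)
    have h2 : finrank ℚ ℚ⟮Complex.I⟯ ≤ 2 := by
      rw [adjoin.finrank hIQ]
      have hdvd : minpoly ℚ Complex.I ∣ Polynomial.X ^ 2 + 1 := minpoly.dvd _ _ (by simp)
      have hdeg2 : (Polynomial.X ^ 2 + 1 : Polynomial ℚ).natDegree = 2 := by compute_degree!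
      rw [← hdeg2]
      refine Polynomial.natDegree_le_of_dvd hdvd fun h => ?_
      rw [h] at hdeg2
      simp at hdeg2
    rw [h3]
    omega
  exact exists_ncard_fibre_le_of_field (algebraMap K ℂ) t j rfl rfl hrank hint hdeg hq hε

theorem finite_setOf_abs_le (Y : ℝ) : {n : ℤ | |(n : ℝ)| ≤ Y}.Finite := by
  refine (Set.finite_Icc (-⌈Y⌉) ⌈Y⌉).subset fun n hn => ?_
  have h := abs_le.1 (show |(n : ℝ)| ≤ Y from hn)
  have h1 : (n : ℝ) ≤ ⌈Y⌉ := h.2.trans (Int.le_ceil Y)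
  have h2 : (-⌈Y⌉ : ℝ) ≤ n := by linarith [Int.le_ceil Y]
  exact ⟨by exact_mod_cast h2, by exact_mod_cast h1⟩

theorem finite_setE (θ : ℝ) (q : ℕ) (Y₁ Y₂ : ℝ) : (setE θ q Y₁ Y₂).Finite :=
  (finite_setOf_abs_le Y₂).subset fun _ hn => hn.2

theorem setR_zero_subset (θ Y₁ Y₂ : ℝ) : setR θ 0 Y₁ Y₂ ⊆ {(0, 0)} := by
  rintro ⟨x, y⟩ ⟨-, -, -, -, n, -, h⟩
  simp only [CharP.cast_eq_zero, ne_eq, OfNat.ofNat_ne_zero, not_false_eq_true, zero_pow,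
    zero_mul] at h
  have hx : x = 0 := by nlinarith [sq_nonneg x, sq_nonneg y]
  have hy : y = 0 := by nlinarith [sq_nonneg x, sq_nonneg y]
  simp [hx, hy]

theorem zero_mem_setE_zero {θ : ℝ} (hdeg : (minpoly ℚ θ).natDegree = 3) {Y₁ Y₂ : ℝ}
    (hY₁ : 0 ≤ Y₁) (hY₂ : 0 ≤ Y₂) : 0 ∈ setE θ 0 Y₁ Y₂ := by
  have h0 : maxCoeff θ 0 = 0 := by simpa using maxCoeff_eq hdeg 0 0 0
  refine ⟨⟨0, zero_mem _, 0, zero_mem _, ?_, ?_, by simp⟩, by simpa using hY₂⟩ <;> simpa [h0]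

end CubicSquares

/-! ### Summation over the integers represented -/

open CubicSquares in
theorem lemma1p4 (θ : ℝ) (hint : IsIntegral ℤ θ) (hdeg : (minpoly ℚ θ).natDegree = 3)
    (q : ℕ) (ε : ℝ) (hε : 0 < ε) :
    ∃ C : ℝ, 0 < C ∧ ∀ Y₁ Y₂ : ℝ, 2 ≤ Y₁ → 2 ≤ Y₂ →
      (CubicSquares.setE θ q Y₁ Y₂).Finite ∧ (CubicSquares.setR θ q Y₁ Y₂).Finite ∧
      C * ((CubicSquares.setR θ q Y₁ Y₂).ncard : ℝ) * Y₂ ^ (-ε) * (Real.log Y₁) ^ (-2 : ℤ) ≤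
        ((CubicSquares.setE θ q Y₁ Y₂).ncard : ℝ) := by
  suffices h : ∃ C : ℝ, 0 < C ∧ ∀ Y₁ Y₂ : ℝ, 2 ≤ Y₁ → 2 ≤ Y₂ → (setR θ q Y₁ Y₂).Finite ∧
      ((setR θ q Y₁ Y₂).ncard : ℝ) ≤
        C * Y₂ ^ ε * Real.log Y₁ ^ 2 * ((setE θ q Y₁ Y₂).ncard : ℝ) by
    obtain ⟨C, hC, h⟩ := h
    refine ⟨C⁻¹, inv_pos.2 hC, fun Y₁ Y₂ hY₁ hY₂ => ⟨finite_setE θ q Y₁ Y₂, (h Y₁ Y₂ hY₁ hY₂).1, ?_⟩⟩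
    have hl : 0 < Real.log Y₁ := Real.log_pos (by linarith)
    have hY : 0 < Y₂ ^ ε := Real.rpow_pos_of_pos (by linarith) _
    rw [Real.rpow_neg (by linarith), zpow_neg, zpow_ofNat]
    calc _ ≤ C⁻¹ * (C * Y₂ ^ ε * Real.log Y₁ ^ 2 * ((setE θ q Y₁ Y₂).ncard : ℝ)) *
          (Y₂ ^ ε)⁻¹ * (Real.log Y₁ ^ 2)⁻¹ := by
          gcongr
          exact (h Y₁ Y₂ hY₁ hY₂).2
      _ = _ := by field_simp
  -- For `q = 0` the element `m` vanishes and the divisor count fails, but then the only possible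
  -- pair is `(0, 0)` and `0` lies in `setE`.
  rcases eq_or_ne q 0 with rfl | hq
  · have hl2 : 0 < Real.log 2 := Real.log_pos (by norm_num)
    refine ⟨(Real.log 2 ^ 2)⁻¹, by positivity, fun Y₁ Y₂ hY₁ hY₂ => ?_⟩
    have hsub := setR_zero_subset θ Y₁ Y₂
    have hfin : ({(0, 0)} : Set (ℝ × ℝ)).Finite := Set.finite_singleton _
    refine ⟨hfin.subset hsub, ?_⟩
    have h1 : ((setR θ 0 Y₁ Y₂).ncard : ℝ) ≤ 1 := by
      have := Set.ncard_le_ncard hsub hfin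
      rw [Set.ncard_singleton] at this
      exact_mod_cast this
    have h2 : (1 : ℝ) ≤ (setE θ 0 Y₁ Y₂).ncard := by
      have : 0 < (setE θ 0 Y₁ Y₂).ncard := (Set.ncard_pos (finite_setE θ 0 Y₁ Y₂)).2
        ⟨0, zero_mem_setE_zero hdeg (by linarith) (by linarith)⟩
      exact_mod_cast this
    have h3 : (1 : ℝ) ≤ Y₂ ^ ε := Real.one_le_rpow (by linarith) hε.le
    have h4 : 1 ≤ (Real.log 2 ^ 2)⁻¹ * Real.log Y₁ ^ 2 := by
      rw [inv_mul_eq_div, one_le_div (by positivity)]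
      gcongr
    calc ((setR θ 0 Y₁ Y₂).ncard : ℝ) ≤ 1 * 1 * 1 := by linarith
      _ ≤ ((Real.log 2 ^ 2)⁻¹ * Real.log Y₁ ^ 2) * Y₂ ^ ε * (setE θ 0 Y₁ Y₂).ncard := by gcongr
      _ = _ := by ring
  · obtain ⟨C, hC, h⟩ := exists_ncard_fibre_le hint hdeg hq hε
    refine ⟨C, hC, fun Y₁ Y₂ hY₁ hY₂ => ?_⟩
    -- Any choice of `n` for each pair will do; uniqueness is not needed.
    have hex : ∀ ω ∈ setR θ q Y₁ Y₂, ∃ n ∈ setE θ q Y₁ Y₂, ω ∈ fibre θ q Y₁ n := by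
      rintro ω ⟨h₁, h₂, h₃, h₄, n, hn, hω⟩
      exact ⟨n, ⟨⟨ω.1, h₁, ω.2, h₂, h₃, h₄, hω.symm⟩, hn⟩, h₁, h₂, h₃, h₄, hω⟩
    choose! f hfE hf using hex
    have hM : 0 ≤ C * Y₂ ^ ε * Real.log Y₁ ^ 2 := by positivity
    refine finite_and_ncard_le_mul f (finite_setE θ q Y₁ Y₂) hfE hM fun n hn => ?_
    obtain ⟨hfin, hcard⟩ := h Y₁ Y₂ hY₁ hY₂ n hn.2
    have hsub : {ω ∈ setR θ q Y₁ Y₂ | f ω = n} ⊆ fibre θ q Y₁ n := by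
      rintro ω ⟨hω, rfl⟩
      exact hf ω hω
    exact ⟨hfin.subset hsub, le_trans (by exact_mod_cast Set.ncard_le_ncard hsub hfin) hcard⟩
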